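/- A copula is the distribution function $C$ of a random vector $(U,V)$ whose two marginals are uniform on $[0,1]$. The Markov product $C*D$ of two copulas is the distribution function of $(U_0,U_2)$, where $U_0,U_1,U_2$ is a Markov chain such that $(U_0,U_1)$ has distribution function $C$ and $(U_1,U_2)$ has distribution function $D$. The copula of a pair $(X,Y)$ of real random variables with distribution functions $F_X,F_Y$ is the copula $C$ with $C(F_X(x),F_Y(y))=P(X\le x,\,Y\le y)$ for all $x,y$ which, if $F_X$ or $F_Y$ has jumps, is moreover affine in its first coordinate on every interval $[F_X(x-),F_X(x)]$ and affine in its second coordinate on every interval $[F_Y(y-),F_Y(y)]$. Let $X_0,X_1,\dots$ be a real-valued stationary Markov chain governed by the copula $C$ (that is, $X_0,X_1,\dots$ has the Markov property, all $X_n$ have the same distribution, and $C$ is the copula of $(X_n,X_{n+1})$ for every $n\ge 0$). Suppose that $C$ is idempotent: $C*C=C$. Then: 1. The sequence is spreadable: $(X_{k_0},X_{k_1},\dots)\stackrel{d}{=}(X_0,X_1,\dots)$ for all $k_0<k_1<\cdots$. 2. The sequence is exchangeable: $(X_{\pi(0)},X_{\pi(1)},\dots)\stackrel{d}{=}(X_0,X_1,\dots)$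 for every permutation $\pi$ of $\{0,1,\dots\}$ that moves only finitely many indices. 3. For all $n\ge 0$ and all Borel sets $A$, $P(X_{n+1}\in A\mid X_0,\dots,X_n)=P(X_{n+1}\in A\mid X_0)$ almost surely. 4. There is a directing random measure $\eta$ of $X_0,X_1,\dots$, that is, a random probability measure on $\mathbb R$ such that, given $\sigma(\eta)$, the variables $X_0,X_1,\dots$ are conditionally i.i.d. with distribution $\eta$. It is unique up to almost sure equality, and it has a version that is $\sigma(X_0)$-measurable, so that $\sigma(\eta)\subseteq\sigma(X_0)$. Moreover, given $X_0$, the variables $X_1,X_2,\dots$ are conditionally i.i.d. with distribution $\eta$. -/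

import Mathlib

open MeasureTheory ProbabilityTheory Set Filter
open scoped Topology

/-- A (two-dimensional) copula, given by the probability law on `ℝ × ℝ` whose two marginals are
uniform on `[0,1]`; the distribution function of this law is `Copula.cdf`, and it determines the
copula (`Copula.ext_cdf`). -/
@[ext]
structure Copula where
  law : Measure (ℝ × ℝ)
  fst_law : law.fst = volume.restrict (Icc (0 : ℝ) 1)
  snd_law : law.snd = volume.restrict (Icc (0 : ℝ) 1)

namespace Copula

instance (C : Copula) : IsProbabilityMeasure C.law := by
  constructor
  rw [← Measure.fst_univ, C.fst_law]
  simp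

/-- The distribution function `C(u,v)`. -/
noncomputable def cdf (C : Copula) (u v : ℝ) : ℝ := C.law.real (Iic u ×ˢ Iic v)

/-- Two copulas with the same distribution function are equal. -/
theorem ext_cdf {C D : Copula} (h : ∀ u v, C.cdf u v = D.cdf u v) : C = D := by
  apply Copula.ext
  have hg : borel ℝ = MeasurableSpace.generateFrom (range Iic) := borel_eq_generateFrom_Iic ℝ
  have hspan : IsCountablySpanning (range (Iic : ℝ → Set ℝ)) :=
    ⟨fun n : ℕ => Iic (n : ℝ), fun n => ⟨_, rfl⟩, by
      ext x
      simpa using exists_nat_ge x⟩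
  have hgen := generateFrom_eq_prod (α := ℝ) (β := ℝ)
    ((BorelSpace.measurable_eq (α := ℝ)).trans hg).symm
    ((BorelSpace.measurable_eq (α := ℝ)).trans hg).symm hspan hspan
  refine ext_of_generate_finite _ hgen.symm (isPiSystem_Iic.prod isPiSystem_Iic) ?_ (by simp)
  rintro s ⟨_, ⟨u, rfl⟩, _, ⟨v, rfl⟩, rfl⟩
  exact (measureReal_eq_measureReal_iff).1 (h u v)

/-- The Markov product `C ∗ D`: the law of `(U₀, U₂)`, where `U₀, U₁, U₂` is the Markov chain such
that `(U₀, U₁)` has law `C` and `(U₁, U₂)` has law `D`. Here `((U₀, U₁), U₂)` is distributed as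
`C.law ⊗ₘ κ`, where `κ` depends on `U₁` only and is the conditional law of the second coordinate
given the first under `D`. -/
noncomputable def markovProduct (C D : Copula) : Copula where
  law := (C.law ⊗ₘ Kernel.prodMkLeft ℝ D.law.condKernel).map (fun p => (p.1.1, p.2))
  fst_law := by
    rw [Measure.fst, Measure.map_map (by fun_prop) (by fun_prop)]
    have : (Prod.fst ∘ fun p : (ℝ × ℝ) × ℝ => (p.1.1, p.2)) = Prod.fst ∘ Prod.fst := rfl
    rw [this, ← Measure.map_map (by fun_prop) (by fun_prop)]
    change ((C.law ⊗ₘ Kernel.prodMkLeft ℝ D.law.condKernel).fst).fst = _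
    rw [Measure.fst_compProd, C.fst_law]
  snd_law := by
    have hd : D.law.fst ⊗ₘ D.law.condKernel = D.law := D.law.disintegrate D.law.condKernel
    have hD : D.law.condKernel ∘ₘ C.law.snd = volume.restrict (Icc (0 : ℝ) 1) := by
      rw [C.snd_law, ← D.fst_law, ← Measure.snd_compProd, hd, D.snd_law, D.fst_law]
    rw [Measure.snd, Measure.map_map (by fun_prop) (by fun_prop)]
    change (C.law ⊗ₘ Kernel.prodMkLeft ℝ D.law.condKernel).snd = _
    rw [Measure.snd_compProd, ← hD]
    ext s hs
    rw [Measure.bind_apply hs (Kernel.aemeasurable _), Measure.bind_apply hs (Kernel.aemeasurable _),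
      Measure.snd, lintegral_map (Kernel.measurable_coe _ hs) measurable_snd]
    rfl

/-- `C ∗ C = C`. -/
def IsIdempotent (C : Copula) : Prop := C.markovProduct C = C

end Copula

section Processes

variable {Ω : Type*} {mΩ : MeasurableSpace Ω}

/-- `C` is the copula of `(X, Y)` under `P`: it satisfies `C(F_X(x), F_Y(y)) = P(X ≤ x, Y ≤ y)` and,
at the jumps of `F_X` and `F_Y`, where this does not determine `C`, it is interpolated linearly in
each coordinate. If `F_X` and `F_Y` are continuous, then the last two conditions are void. -/
structure HasCopula (P : Measure Ω) (X Y : Ω → ℝ) (C : Copula) : Prop where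
  sklar : ∀ x y : ℝ, C.cdf (ProbabilityTheory.cdf (P.map X) x) (ProbabilityTheory.cdf (P.map Y) y)
    = P.real {ω | X ω ≤ x ∧ Y ω ≤ y}
  interp_left : ∀ x v : ℝ, ∀ t ∈ Icc (0 : ℝ) 1,
    C.cdf ((1 - t) * Function.leftLim (ProbabilityTheory.cdf (P.map X)) x
        + t * ProbabilityTheory.cdf (P.map X) x) v
      = (1 - t) * C.cdf (Function.leftLim (ProbabilityTheory.cdf (P.map X)) x) v
        + t * C.cdf (ProbabilityTheory.cdf (P.map X) x) v
  interp_right : ∀ y u : ℝ, ∀ t ∈ Icc (0 : ℝ) 1,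
    C.cdf u ((1 - t) * Function.leftLim (ProbabilityTheory.cdf (P.map Y)) y
        + t * ProbabilityTheory.cdf (P.map Y) y)
      = (1 - t) * C.cdf u (Function.leftLim (ProbabilityTheory.cdf (P.map Y)) y)
        + t * C.cdf u (ProbabilityTheory.cdf (P.map Y) y)

/-- `σ(X₀, …, Xₙ)`. -/
abbrev sigmaPast (X : ℕ → Ω → ℝ) (n : ℕ) : MeasurableSpace Ω :=
  ⨆ i ∈ Set.Iic n, MeasurableSpace.comap (X i) inferInstance

/-- `σ(Y)`, for a random variable or random measure `Y`. -/
abbrev sigmaOf {S : Type*} [MeasurableSpace S] (Y : Ω → S) : MeasurableSpace Ω :=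
  MeasurableSpace.comap Y inferInstance

/-- The sequence `X₀, X₁, …` of random variables has the Markov property
`P(Xₙ₊₁ ∈ A | X₀, …, Xₙ) = P(Xₙ₊₁ ∈ A | Xₙ)` a.s. -/
structure IsMarkovChain (P : Measure Ω) (X : ℕ → Ω → ℝ) : Prop where
  measurable : ∀ n, Measurable (X n)
  markov : ∀ (n : ℕ) (A : Set ℝ), MeasurableSet A →
    P⟦X (n + 1) ⁻¹' A | sigmaPast X n⟧ =ᵐ[P] P⟦X (n + 1) ⁻¹' A | sigmaOf (X n)⟧

/-- `X₀, X₁, …` is a stationary Markov chain governed by the copula `C`: it is a Markov chain, its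
terms have the same distribution, and `C` is the copula of every pair `(Xₙ, Xₙ₊₁)`. -/
structure IsMarkovChainWithCopula (P : Measure Ω) (X : ℕ → Ω → ℝ) (C : Copula) : Prop
    extends IsMarkovChain P X where
  identDistrib : ∀ n, IdentDistrib (X n) (X 0) P P
  hasCopula : ∀ n, HasCopula P (X n) (X (n + 1)) C

/-- `(ξ₀, ξ₁, …)` and `(ξ_{k₀}, ξ_{k₁}, …)` have the same law for all `k₀ < k₁ < ⋯`. -/
def IsSpreadable (P : Measure Ω) (ξ : ℕ → Ω → ℝ) : Prop :=
  ∀ k : ℕ → ℕ, StrictMono k →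
    IdentDistrib (fun ω i => ξ (k i) ω) (fun ω i => ξ i ω) P P

/-- `(ξ₀, ξ₁, …)` and `(ξ_{k₀}, ξ_{k₁}, …)` have the same law for all finitely supported
permutations `k`. -/
def IsExchangeable (P : Measure Ω) (ξ : ℕ → Ω → ℝ) : Prop :=
  ∀ k : Equiv.Perm ℕ, {i | k i ≠ i}.Finite →
    IdentDistrib (fun ω i => ξ (k i) ω) (fun ω i => ξ i ω) P P

/-- Given `m`, the variables `ξ₀, ξ₁, …` are conditionally i.i.d. with the `m`-measurable random
probability measure `ν` as their common conditional distribution. -/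
structure IsCondIIDWith (P : Measure Ω) (m : MeasurableSpace Ω) (ξ : ℕ → Ω → ℝ)
    (ν : Ω → Measure ℝ) : Prop where
  le : m ≤ mΩ
  measurable : Measurable[m] ν
  isProbabilityMeasure : ∀ ω, IsProbabilityMeasure (ν ω)
  condProb : ∀ (s : Finset ℕ) (A : ℕ → Set ℝ), (∀ i, MeasurableSet (A i)) →
    P⟦⋂ i ∈ s, ξ i ⁻¹' A i | m⟧ =ᵐ[P] fun ω => ∏ i ∈ s, (ν ω).real (A i)

/-- `η` is a directing random measure of `ξ₀, ξ₁, …`: given `σ(η)`, the sequence is conditionally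
i.i.d. with distribution `η`. -/
def IsDirectingMeasure (P : Measure Ω) (ξ : ℕ → Ω → ℝ) (η : Ω → Measure ℝ) : Prop :=
  IsCondIIDWith P (sigmaOf η) ξ η

end Processes

/-! Let `κ` be the transition kernel and `B` a Borel set. Idempotence says that `(U₀, U₂)` and `(U₀,
U₁)` have the same law; read through the quantile function it gives `E[κ(X₀,B) κ(X₁,B)] = E[κ(X₀,B)
1_B(X₁)] = E[κ(X₀,B)²]` (`Copula.IsIdempotent.lintegral_mul`). By stationarity `E[(κ(X₀,B) -
κ(X₁,B))²] = 0`, so the kernel is a.s. constant along the chain (`ae_kernel_eq_of_lintegral_mul`).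
If the marginal has atoms, passing from copula to chain requires that the law of `Q(U₁)` given `U₀ =
u` depend on `Q(u)` only; this is what affine interpolation provides (`Copula.map_id_quantile_eq`).

Put `η = κ(X₀,·)`. By the Markov property every `Xₙ₊₁` has conditional law `κ(Xₙ,·) = η` given the
past, and `X₀` has conditional law `η` given `σ(η)`, since constancy of the kernel and stationarity
allow `X₁` to be exchanged for `X₀` (`condExp_zero_ae_eq`). Conditioning successively along the
filtration gives the conditional i.i.d. property (`isCondIIDWith_of_filtration`). Its product
formula does not see the indices, whence spreadability and exchangeability. Uniqueness holds because
`η(A)` is the `L²` limit of the empirical frequencies of `A` (`IsCondIIDWith.ae_eq`). -/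

/-- Probability measures on the plane are determined by their values on quadrants. -/
theorem MeasureTheory.Measure.ext_of_Iic_prod_Iic {μ ν : Measure (ℝ × ℝ)} [IsProbabilityMeasure μ]
    [IsProbabilityMeasure ν] (h : ∀ u v, μ.real (Iic u ×ˢ Iic v) = ν.real (Iic u ×ˢ Iic v)) :
    μ = ν := by
  have hg : borel ℝ = MeasurableSpace.generateFrom (range Iic) := borel_eq_generateFrom_Iic ℝ
  have hspan : IsCountablySpanning (range (Iic : ℝ → Set ℝ)) :=
    ⟨fun n : ℕ => Iic (n : ℝ), fun n => ⟨_, rfl⟩, by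
      ext x
      simpa using exists_nat_ge x⟩
  have hgen := generateFrom_eq_prod (α := ℝ) (β := ℝ)
    ((BorelSpace.measurable_eq (α := ℝ)).trans hg).symm
    ((BorelSpace.measurable_eq (α := ℝ)).trans hg).symm hspan hspan
  refine ext_of_generate_finite _ hgen.symm (isPiSystem_Iic.prod isPiSystem_Iic) ?_ (by simp)
  rintro s ⟨_, ⟨u, rfl⟩, _, ⟨v, rfl⟩, rfl⟩
  exact (measureReal_eq_measureReal_iff).1 (h u v)

/-- Random probability measures on the line that agree a.s. on each Borel set agree a.s. -/
theorem ae_eq_of_forall_measureReal_ae_eq {Ω : Type*} [MeasurableSpace Ω] {P : Measure Ω}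
    {ν ν' : Ω → Measure ℝ} (hν : ∀ ω, IsProbabilityMeasure (ν ω))
    (hν' : ∀ ω, IsProbabilityMeasure (ν' ω))
    (h : ∀ A, MeasurableSet A → ∀ᵐ ω ∂P, (ν ω).real A = (ν' ω).real A) : ν =ᵐ[P] ν' := by
  have h1 : ∀ᵐ ω ∂P, ∀ q : ℚ, (ν ω).real (Iic (q : ℝ)) = (ν' ω).real (Iic (q : ℝ)) :=
    ae_all_iff.2 fun q => h _ measurableSet_Iic
  filter_upwards [h1] with ω hω
  have := hν ω
  have := hν' ω
  refine ext_of_generate_finite _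
    ((BorelSpace.measurable_eq (α := ℝ)).trans Real.borel_eq_generateFrom_Iic_rat)
    Real.isPiSystem_Iic_rat ?_ (by simp)
  intro s hs
  simp only [mem_iUnion, mem_singleton_iff] at hs
  obtain ⟨q, rfl⟩ := hs
  exact (measureReal_eq_measureReal_iff).1 (hω q)

/-! ### Quantile transform of a law on the line. -/

section Quantile

open Classical in
/-- The quantile function `u ↦ inf {x | u ≤ F x}` of a probability law on the line, on `(0,1)`. -/
noncomputable def quantile (μ : Measure ℝ) (u : ℝ) : ℝ :=
  -- At `u = 0` the set is unbounded below and at `u = 1` it may be empty; the default 0 is harmless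
  -- because the uniform law does not charge the endpoints.
  if u ∈ Ioo (0 : ℝ) 1 then sInf {x | u ≤ ProbabilityTheory.cdf μ x} else 0

theorem quantile_le_iff (μ : Measure ℝ) {u x : ℝ} (hu : u ∈ Ioo (0 : ℝ) 1) :
    quantile μ u ≤ x ↔ u ≤ ProbabilityTheory.cdf μ x := by
  set F := ProbabilityTheory.cdf μ
  have hne : {x | u ≤ F x}.Nonempty := by
    obtain ⟨y, hy⟩ := ((tendsto_cdf_atTop μ).eventually (lt_mem_nhds hu.2)).exists
    exact ⟨y, hy.le⟩
  have hbdd : BddBelow {x | u ≤ F x} := by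
    obtain ⟨y, hy⟩ := ((tendsto_cdf_atBot μ).eventually (gt_mem_nhds hu.1)).exists
    exact ⟨y, fun z hz => le_of_not_gt fun hzy =>
      (hz.trans ((monotone_cdf μ) hzy.le)).not_gt hy⟩
  -- Right continuity of `F` puts the infimum itself in the set.
  have hmem : u ≤ F (sInf {x | u ≤ F x}) := by
    have hc : Tendsto F (𝓝[>] sInf {x | u ≤ F x}) (𝓝 (F (sInf {x | u ≤ F x}))) :=
      (F.right_continuous _).mono Ioi_subset_Ici_self
    refine ge_of_tendsto hc ?_
    filter_upwards [self_mem_nhdsWithin] with y hy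
    obtain ⟨z, hz, hzy⟩ := (csInf_lt_iff hbdd hne).1 hy
    exact hz.trans (monotone_cdf μ hzy.le)
  rw [quantile, if_pos hu]
  exact ⟨fun h => hmem.trans (monotone_cdf μ h), fun h => csInf_le hbdd h⟩

theorem measurable_quantile (μ : Measure ℝ) : Measurable (quantile μ) := by
  classical
  refine measurable_of_Iic fun x => ?_
  have : quantile μ ⁻¹' Iic x = (Ioo 0 1 ∩ Iic (ProbabilityTheory.cdf μ x)) ∪
      ((Ioo 0 1)ᶜ ∩ {_u | (0 : ℝ) ≤ x}) := by
    ext u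
    by_cases hu : u ∈ Ioo (0 : ℝ) 1
    · simp [quantile_le_iff μ hu, hu, -mem_Ioo]
    · simp [quantile, hu, -mem_Ioo]
  rw [this]
  exact (measurableSet_Ioo.inter measurableSet_Iic).union
    (measurableSet_Ioo.compl.inter (MeasurableSet.const _))

theorem ae_mem_Ioo_restrict_Icc :
    ∀ᵐ u ∂(volume.restrict (Icc (0 : ℝ) 1)), u ∈ Ioo (0 : ℝ) 1 := by
  rw [← restrict_Ioo_eq_restrict_Icc]
  exact ae_restrict_mem measurableSet_Ioo

theorem quantile_preimage_Iic_ae_eq (μ : Measure ℝ) (x : ℝ) :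
    quantile μ ⁻¹' Iic x =ᵐ[volume.restrict (Icc (0 : ℝ) 1)]
      Iic (ProbabilityTheory.cdf μ x) := by
  filter_upwards [ae_mem_Ioo_restrict_Icc] with u hu
  exact propext (quantile_le_iff μ hu)

/-- The two sets can differ inside `(0,1)` only at the single point `u = F(x-)`: if `Q u ≥ x`, then
`F y < u` for all `y < x`, so `F(x-) ≤ u`. -/
theorem quantile_preimage_Iio_ae_eq (μ : Measure ℝ) (x : ℝ) :
    quantile μ ⁻¹' Iio x =ᵐ[volume.restrict (Icc (0 : ℝ) 1)]
      Iic (Function.leftLim (ProbabilityTheory.cdf μ) x) := by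
  have hne : ∀ᵐ u ∂(volume.restrict (Icc (0 : ℝ) 1)),
      u ≠ Function.leftLim (ProbabilityTheory.cdf μ) x := by
    exact ae_restrict_of_ae (Measure.ae_ne volume _)
  filter_upwards [ae_mem_Ioo_restrict_Icc, hne] with u hu hux
  refine propext ⟨fun h => ?_, fun h => ?_⟩
  · exact ((quantile_le_iff μ hu).1 le_rfl).trans ((monotone_cdf μ).le_leftLim h)
  · by_contra hq
    refine hux (le_antisymm h ?_)
    refine le_of_tendsto ((monotone_cdf μ).tendsto_leftLim x) ?_
    filter_upwards [self_mem_nhdsWithin] with y hy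
    refine le_of_not_ge fun hle => hq ?_
    exact ((quantile_le_iff μ hu).2 hle).trans_lt hy

theorem map_quantile (μ : Measure ℝ) [IsProbabilityMeasure μ] :
    (volume.restrict (Icc (0 : ℝ) 1)).map (quantile μ) = μ := by
  refine Measure.ext_of_Iic _ _ fun x => ?_
  rw [Measure.map_apply (measurable_quantile μ) measurableSet_Iic,
    measure_congr (quantile_preimage_Iic_ae_eq μ x), Measure.restrict_apply measurableSet_Iic,
    ← ofReal_cdf]
  have : Iic (ProbabilityTheory.cdf μ x) ∩ Icc 0 1 = Icc 0 (ProbabilityTheory.cdf μ x) := by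
    ext u
    simp only [mem_inter_iff, mem_Iic, mem_Icc]
    have := cdf_le_one μ x
    constructor
    · tauto
    · exact fun h => ⟨h.2, h.1, h.2.trans this⟩
  rw [this, Real.volume_Icc, sub_zero]

end Quantile

/-! ### From the copula to the transition kernel. -/

namespace Copula

theorem ae_fst_mem_Ioo (C : Copula) : ∀ᵐ p ∂C.law, p.1 ∈ Ioo (0 : ℝ) 1 := by
  refine ae_of_ae_map (f := Prod.fst) (p := fun u => u ∈ Ioo (0 : ℝ) 1) (by fun_prop) ?_
  change ∀ᵐ u ∂C.law.fst, u ∈ Ioo (0 : ℝ) 1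
  rw [C.fst_law]
  exact ae_mem_Ioo_restrict_Icc

theorem ae_snd_mem_Ioo (C : Copula) : ∀ᵐ p ∂C.law, p.2 ∈ Ioo (0 : ℝ) 1 := by
  refine ae_of_ae_map (f := Prod.snd) (p := fun u => u ∈ Ioo (0 : ℝ) 1) (by fun_prop) ?_
  change ∀ᵐ u ∂C.law.snd, u ∈ Ioo (0 : ℝ) 1
  rw [C.snd_law]
  exact ae_mem_Ioo_restrict_Icc

/-- If both marginals of `ρ` are `μ` and `C` is a copula of `ρ`, then `ρ` is the image of `C` under
the quantile transform. -/
theorem map_quantile_eq (C : Copula) {μ : Measure ℝ} {ρ : Measure (ℝ × ℝ)}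
    [IsProbabilityMeasure ρ]
    (h : ∀ x y, C.cdf (ProbabilityTheory.cdf μ x) (ProbabilityTheory.cdf μ y)
      = ρ.real (Iic x ×ˢ Iic y)) :
    C.law.map (Prod.map (quantile μ) (quantile μ)) = ρ := by
  have hQ := measurable_quantile μ
  have hQQ : Measurable (Prod.map (quantile μ) (quantile μ)) := hQ.prodMap hQ
  have := Measure.isProbabilityMeasure_map (μ := C.law) hQQ.aemeasurable
  refine Measure.ext_of_Iic_prod_Iic fun x y => ?_
  rw [← h, Copula.cdf, measureReal_def, measureReal_def,
    Measure.map_apply hQQ (measurableSet_Iic.prod measurableSet_Iic)]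
  congr 1
  refine measure_congr ?_
  filter_upwards [C.ae_fst_mem_Ioo, C.ae_snd_mem_Ioo] with p hp1 hp2
  exact propext (and_congr (quantile_le_iff μ hp1) (quantile_le_iff μ hp2))

/-- If `C` is affine in its first coordinate on the jumps of `F_μ`, then the conditional law of
`Q(V)` given `U = u`, where `(U, V)` has law `C` and `Q` is the quantile function of `μ`, depends on
`Q(u)` only. -/
theorem map_id_quantile_eq (C : Copula) {μ : Measure ℝ} [IsProbabilityMeasure μ]
    {κ : Kernel ℝ ℝ} [IsMarkovKernel κ]
    (hρ : C.law.map (Prod.map (quantile μ) (quantile μ)) = μ ⊗ₘ κ)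
    (h : ∀ x v : ℝ, ∀ t ∈ Icc (0 : ℝ) 1,
      C.cdf ((1 - t) * Function.leftLim (ProbabilityTheory.cdf μ) x
          + t * ProbabilityTheory.cdf μ x) v
        = (1 - t) * C.cdf (Function.leftLim (ProbabilityTheory.cdf μ) x) v
          + t * C.cdf (ProbabilityTheory.cdf μ x) v) :
    C.law.map (Prod.map id (quantile μ)) =
      (volume.restrict (Icc (0 : ℝ) 1)) ⊗ₘ κ.comap (quantile μ) (measurable_quantile μ) := by
  set Q := quantile μ with hQdef
  have hQ : Measurable Q := measurable_quantile μ
  set l : Measure ℝ := volume.restrict (Icc (0 : ℝ) 1) with hl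
  have hlp : IsProbabilityMeasure l := ⟨by simp [hl]⟩
  have hiQ : Measurable (Prod.map id Q : ℝ × ℝ → ℝ × ℝ) := measurable_id.prodMap hQ
  have := Measure.isProbabilityMeasure_map (μ := C.law) hiQ.aemeasurable
  set M := C.law.map (Prod.map id Q) with hM
  set N := l ⊗ₘ κ.comap Q hQ with hN
  have hM1 : M.fst = l := by
    rw [Measure.fst, hM, Measure.map_map measurable_fst hiQ, hl, ← C.fst_law]
    rfl
  have hN1 : N.fst = l := Measure.fst_compProd _ _
  -- sets whose first coordinate is, up to a null set, described by `Q`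
  have key : ∀ A B S : Set ℝ, MeasurableSet A → MeasurableSet B → MeasurableSet S →
      Q ⁻¹' A =ᵐ[l] S → M.real (S ×ˢ B) = N.real (S ×ˢ B) := by
    intro A B S hA hB hS hAS
    have hcongr : ∀ (K : Measure (ℝ × ℝ)), K.fst = l →
        K (S ×ˢ B) = K ((Q ⁻¹' A) ×ˢ B) := by
      intro K hK
      refine measure_congr ?_
      have : ∀ᵐ p ∂K, p.1 ∈ Q ⁻¹' A ↔ p.1 ∈ S := by
        refine ae_of_ae_map (f := Prod.fst) (p := fun u => u ∈ Q ⁻¹' A ↔ u ∈ S) (by fun_prop) ?_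
        change ∀ᵐ u ∂K.fst, _
        rw [hK]
        exact hAS.mem_iff
      filter_upwards [this] with p hp
      exact propext (and_congr_left fun _ => hp.symm)
    rw [measureReal_def, measureReal_def, hcongr M hM1, hcongr N hN1]
    congr 1
    rw [hM, Measure.map_apply hiQ ((hQ hA).prod hB), hN,
      Measure.compProd_apply_prod (hQ hA) hB]
    have e1 : C.law (Prod.map id Q ⁻¹' ((Q ⁻¹' A) ×ˢ B)) = (μ ⊗ₘ κ) (A ×ˢ B) := by
      rw [← hρ, Measure.map_apply (hQ.prodMap hQ) (hA.prod hB)]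
      rfl
    rw [e1, Measure.compProd_apply_prod hA hB]
    -- Writing `μ` as the image of the uniform law under `Q` turns the integral over `A` into one
    -- over `Q ⁻¹' A`.
    conv_lhs => rw [← map_quantile μ]
    rw [setLIntegral_map hA (κ.measurable_coe hB) hQ]
    rfl
  refine Measure.ext_of_Iic_prod_Iic fun u y => ?_
  have hB : MeasurableSet (Iic y) := measurableSet_Iic
  -- Outside `(0,1)` the set `Iic u` is a.s. empty or a.s. everything, so `key` applies directly.
  rcases le_or_gt u 0 with hu0 | hu0
  · refine key ∅ _ _ MeasurableSet.empty hB measurableSet_Iic ?_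
    filter_upwards [ae_mem_Ioo_restrict_Icc] with s hs
    exact propext ⟨fun h => h.elim, fun h => (hs.1.not_ge (le_trans h hu0)).elim⟩
  rcases le_or_gt 1 u with hu1 | hu1
  · refine key univ _ _ MeasurableSet.univ hB measurableSet_Iic ?_
    filter_upwards [ae_mem_Ioo_restrict_Icc] with s hs
    exact propext ⟨fun _ => hs.2.le.trans hu1, fun _ => trivial⟩
  have hu : u ∈ Ioo (0 : ℝ) 1 := ⟨hu0, hu1⟩
  set F := ProbabilityTheory.cdf μ with hF
  set x := Q u with hx
  set a := Function.leftLim F x with ha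
  -- This identifies the distribution function of `M`, so that the interpolation hypothesis `h`
  -- makes it affine on the jump interval `[a, F x]`.
  have hMcdf : ∀ u, M.real (Iic u ×ˢ Iic y) = C.cdf u (F y) := by
    intro u
    rw [Copula.cdf, measureReal_def, measureReal_def, hM,
      Measure.map_apply hiQ (measurableSet_Iic.prod measurableSet_Iic)]
    congr 1
    refine measure_congr ?_
    filter_upwards [C.ae_snd_mem_Ioo] with p hp2
    exact propext (and_congr_right fun _ => quantile_le_iff μ hp2)
  have hend : M.real (Iic (F x) ×ˢ Iic y) = N.real (Iic (F x) ×ˢ Iic y) :=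
    key (Iic x) _ _ measurableSet_Iic hB measurableSet_Iic (quantile_preimage_Iic_ae_eq μ x)
  have hstart : M.real (Iic a ×ˢ Iic y) = N.real (Iic a ×ˢ Iic y) :=
    key (Iio x) _ _ measurableSet_Iio hB measurableSet_Iic (quantile_preimage_Iio_ae_eq μ x)
  have huF : u ≤ F x := (quantile_le_iff μ hu).1 le_rfl
  have hau : a ≤ u := by
    refine le_of_tendsto ((monotone_cdf μ).tendsto_leftLim x) ?_
    filter_upwards [self_mem_nhdsWithin] with z hz
    exact le_of_not_ge fun hle => (((quantile_le_iff μ hu).2 hle).trans_lt hz).false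
  have ha0 : 0 ≤ a := by
    refine ge_of_tendsto ((monotone_cdf μ).tendsto_leftLim x) ?_
    exact Eventually.of_forall fun z => cdf_nonneg μ z
  -- On `(a, F x]` the quantile function is a.s. equal to `x`, so `N` is affine there with slope `κ
  -- x (Iic y)`. As `M` and `N` agree at both ends of the interval, they agree at `u`.
  have hNaff : ∀ w ∈ Icc a (F x), N.real (Iic w ×ˢ Iic y) =
      N.real (Iic a ×ˢ Iic y) + (w - a) * (κ x).real (Iic y) := by
    intro w hw
    have hsplit : (Iic w ×ˢ Iic y : Set (ℝ × ℝ)) = Iic a ×ˢ Iic y ∪ Ioc a w ×ˢ Iic y := by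
      rw [← union_prod, Iic_union_Ioc_eq_Iic hw.1]
    have hdisj : Disjoint (Iic a ×ˢ Iic y : Set (ℝ × ℝ)) (Ioc a w ×ˢ Iic y) := by
      rw [Set.disjoint_prod]
      exact Or.inl (disjoint_left.2 fun s hs hs' => hs'.1.not_ge hs)
    rw [hsplit, measureReal_union hdisj (measurableSet_Ioc.prod hB)]
    congr 1
    have hQx : ∀ᵐ s ∂l, s ∈ Ioc a w → Q s = x := by
      filter_upwards [(quantile_preimage_Iic_ae_eq μ x).mem_iff,
        (quantile_preimage_Iio_ae_eq μ x).mem_iff] with s h1 h2 hs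
      exact le_antisymm (h1.2 (hs.2.trans hw.2)) (le_of_not_gt fun h3 => hs.1.not_ge (h2.1 h3))
    rw [measureReal_def, hN, Measure.compProd_apply_prod measurableSet_Ioc hB]
    have : ∫⁻ s in Ioc a w, κ.comap Q hQ s (Iic y) ∂l = ∫⁻ s in Ioc a w, κ x (Iic y) ∂l := by
      refine setLIntegral_congr_fun_ae measurableSet_Ioc ?_
      filter_upwards [hQx] with s hs hsw
      rw [Kernel.comap_apply, hs hsw]
    have hvol : l (Ioc a w) = ENNReal.ofReal (w - a) := by
      rw [hl, Measure.restrict_apply measurableSet_Ioc, inter_eq_left.2, Real.volume_Ioc]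
      exact fun s hs => ⟨ha0.trans hs.1.le, hs.2.trans (hw.2.trans (cdf_le_one μ x))⟩
    rw [this, setLIntegral_const, hvol, ENNReal.toReal_mul,
      ENNReal.toReal_ofReal (sub_nonneg.2 hw.1), mul_comm]
    rfl
  rcases eq_or_lt_of_le (hau.trans huF) with haF | haF
  · rw [le_antisymm huF (haF ▸ hau)]
    exact hend
  · set t := (u - a) / (F x - a) with ht
    have hd : 0 < F x - a := sub_pos.2 haF
    have htI : t ∈ Icc (0 : ℝ) 1 :=
      ⟨div_nonneg (sub_nonneg.2 hau) hd.le, (div_le_one hd).2 (by linarith)⟩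
    have hut : (1 - t) * a + t * F x = u := by
      rw [ht]; field_simp; ring
    have h1 := h x (F y) t htI
    rw [← ha, hut, ← hMcdf, ← hMcdf, ← hMcdf, hend, hstart] at h1
    rw [h1, hNaff u ⟨hau, huF⟩, hNaff (F x) ⟨haF.le, le_rfl⟩, ← hut]
    ring

/-- For an idempotent copula the kernel `κ` satisfies `E[κ(X,B) κ(Y,B)] = E[κ(X,B)²]`. -/
theorem IsIdempotent.lintegral_mul {C : Copula} (hC : C.IsIdempotent) {μ : Measure ℝ}
    [IsProbabilityMeasure μ] {κ : Kernel ℝ ℝ} [IsMarkovKernel κ]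
    (hρ : C.law.map (Prod.map (quantile μ) (quantile μ)) = μ ⊗ₘ κ)
    (hU : C.law.map (Prod.map id (quantile μ)) =
      (volume.restrict (Icc (0 : ℝ) 1)) ⊗ₘ κ.comap (quantile μ) (measurable_quantile μ))
    {B : Set ℝ} (hB : MeasurableSet B) :
    ∫⁻ p : ℝ × ℝ, κ p.1 B * κ p.2 B ∂(μ ⊗ₘ κ) = ∫⁻ x, κ x B * κ x B ∂μ := by
  set Q := quantile μ with hQdef
  have hQ : Measurable Q := measurable_quantile μ
  have hκB : Measurable fun x => κ x B := κ.measurable_coe hB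
  set K := C.law.condKernel with hK
  -- Both sides disintegrate the law of `(U, Q V)`; uniqueness of disintegrations identifies them
  -- a.e. Since the marginals of `C` coincide, the identity may then be used at the second
  -- coordinate.
  have hKQ : ∀ᵐ u ∂C.law.snd, κ (Q u) B = K u (Q ⁻¹' B) := by
    have h1 : (C.law.fst ⊗ₘ K).map (Prod.map id Q) = C.law.fst ⊗ₘ (K.map Q) := by
      rw [Measure.compProd_map hQ]
    have h2 : C.law.fst ⊗ₘ (K.map Q) = C.law.fst ⊗ₘ (κ.comap Q hQ) := by
      rw [← h1, hK, Measure.disintegrate, hU, C.fst_law]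
    have := Kernel.IsMarkovKernel.map K hQ
    have h3 := Kernel.ae_eq_of_compProd_eq h2
    rw [C.snd_law, ← C.fst_law]
    filter_upwards [h3] with u hu
    rw [← Kernel.map_apply' K hQ u hB, hu, Kernel.comap_apply]
  have hKQ' : ∀ᵐ p ∂C.law, κ (Q p.2) B = K p.2 (Q ⁻¹' B) :=
    ae_of_ae_map (f := Prod.snd) (by fun_prop) hKQ
  have hm1 : Measurable fun p : ℝ × ℝ => κ p.1 B * κ p.2 B := by fun_prop
  have hm2 : Measurable fun p : ℝ × ℝ => κ p.1 B * B.indicator 1 p.2 :=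
    (hκB.comp measurable_fst).mul ((measurable_one.indicator hB).comp measurable_snd)
  have hm3 : Measurable fun p : ℝ × ℝ => κ (Q p.1) B * (Q ⁻¹' B).indicator 1 p.2 :=
    ((hκB.comp hQ).comp measurable_fst).mul
      ((measurable_one.indicator (hQ hB)).comp measurable_snd)
  calc ∫⁻ p : ℝ × ℝ, κ p.1 B * κ p.2 B ∂(μ ⊗ₘ κ)
      = ∫⁻ p, κ (Q p.1) B * κ (Q p.2) B ∂C.law := by
        rw [← hρ, lintegral_map hm1 (hQ.prodMap hQ)]; rfl
    _ = ∫⁻ p : ℝ × ℝ, κ (Q p.1) B * K p.2 (Q ⁻¹' B) ∂C.law := by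
        refine lintegral_congr_ae ?_
        filter_upwards [hKQ'] with p hp
        rw [hp]
    -- Integrating out `U₂` given `(U₀, U₁)` produces `K U₁ (Q ⁻¹' B)`.
    _ = ∫⁻ p : ℝ × ℝ, κ (Q p.1) B * (Q ⁻¹' B).indicator 1 p.2 ∂(C.markovProduct C).law := by
        have hm4 : Measurable fun p : (ℝ × ℝ) × ℝ =>
            κ (Q p.1.1) B * (Q ⁻¹' B).indicator 1 p.2 :=
          hm3.comp (f := fun p : (ℝ × ℝ) × ℝ => (p.1.1, p.2)) (by fun_prop)
        rw [Copula.markovProduct, lintegral_map hm3 (by fun_prop),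
          Measure.lintegral_compProd hm4]
        refine lintegral_congr fun p => ?_
        simp only [Kernel.prodMkLeft_apply]
        rw [lintegral_const_mul _ (measurable_one.indicator (hQ hB)),
          lintegral_indicator_one (hQ hB)]
    _ = ∫⁻ p : ℝ × ℝ, κ (Q p.1) B * (Q ⁻¹' B).indicator 1 p.2 ∂C.law := by
        rw [hC]
    _ = ∫⁻ p : ℝ × ℝ, κ p.1 B * B.indicator 1 p.2 ∂(μ ⊗ₘ κ) := by
        rw [← hρ, lintegral_map hm2 (hQ.prodMap hQ)]; rfl
    _ = ∫⁻ x, κ x B * κ x B ∂μ := by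
        rw [Measure.lintegral_compProd hm2]
        refine lintegral_congr fun x => ?_
        simp only
        rw [lintegral_const_mul _ (measurable_one.indicator hB), lintegral_indicator_one hB]

end Copula

/-! ### Constancy of the kernel along the chain. -/

/-- A stationary `L²` martingale of length two is a.s. constant: if `(X, Y)` has law `μ ⊗ₘ κ` with
both marginals `μ` and `E[κ(X,B) κ(Y,B)] = E[κ(X,B)²]`, then `κ(X,B) = κ(Y,B)` a.s. -/
theorem ae_kernel_eq_of_lintegral_mul {μ : Measure ℝ} [IsProbabilityMeasure μ] {κ : Kernel ℝ ℝ}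
    [IsMarkovKernel κ] (hsnd : (μ ⊗ₘ κ).snd = μ) {B : Set ℝ} (hB : MeasurableSet B)
    (h : ∫⁻ p : ℝ × ℝ, κ p.1 B * κ p.2 B ∂(μ ⊗ₘ κ) = ∫⁻ x, κ x B * κ x B ∂μ) :
    ∀ᵐ p ∂(μ ⊗ₘ κ), (κ p.1).real B = (κ p.2).real B := by
  have hκB : Measurable fun x => κ x B := κ.measurable_coe hB
  have hg : Measurable fun x => (κ x).real B := hκB.ennreal_toReal
  have hgg : Measurable fun x => (κ x).real B * (κ x).real B := hg.mul hg
  have hfin : ∀ x y, κ x B * κ y B < ⊤ := fun x y => ENNReal.mul_lt_top (by simp) (by simp)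
  set I := ∫ x, (κ x).real B * (κ x).real B ∂μ with hI
  have hbound : ∀ x y, ‖(κ x).real B * (κ y).real B‖ ≤ 1 := fun x y => by
    rw [Real.norm_of_nonneg (by positivity)]
    exact mul_le_one₀ measureReal_le_one measureReal_nonneg measureReal_le_one
  have hint : ∀ f f' : ℝ × ℝ → ℝ, Measurable f → Measurable f' →
      Integrable (fun p => (κ (f p)).real B * (κ (f' p)).real B) (μ ⊗ₘ κ) :=
    fun f f' hf hf' => Integrable.of_bound
      ((hg.comp hf).mul (hg.comp hf')).aestronglyMeasurable 1
      (Eventually.of_forall fun p => hbound _ _)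
  have h12 : ∫ p, (κ p.1).real B * (κ p.2).real B ∂(μ ⊗ₘ κ) = I := by
    have e1 : ∀ x y, (κ x).real B * (κ y).real B = (κ x B * κ y B).toReal := fun x y => by
      rw [ENNReal.toReal_mul]; rfl
    simp only [hI, e1]
    rw [integral_toReal (by fun_prop) (Eventually.of_forall fun _ => hfin _ _),
      integral_toReal (by fun_prop) (Eventually.of_forall fun _ => hfin _ _), h]
  have h11 : ∫ p, (κ p.1).real B * (κ p.1).real B ∂(μ ⊗ₘ κ) = I := by
    rw [hI]
    conv_rhs => rw [← Measure.fst_compProd μ κ, Measure.fst]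
    rw [integral_map (by fun_prop) hgg.aestronglyMeasurable]
  have h22 : ∫ p, (κ p.2).real B * (κ p.2).real B ∂(μ ⊗ₘ κ) = I := by
    rw [hI]
    conv_rhs => rw [← hsnd, Measure.snd]
    rw [integral_map (by fun_prop) hgg.aestronglyMeasurable]
  have i11 := hint _ _ measurable_fst measurable_fst
  have i12 := hint _ _ measurable_fst measurable_snd
  have i22 := hint _ _ measurable_snd measurable_snd
  have hsq : ∀ p : ℝ × ℝ, ((κ p.1).real B - (κ p.2).real B) ^ 2 =
      (κ p.1).real B * (κ p.1).real B - (2 * ((κ p.1).real B * (κ p.2).real B)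
        - (κ p.2).real B * (κ p.2).real B) := fun p => by ring
  have i3 : Integrable (fun p : ℝ × ℝ => 2 * ((κ p.1).real B * (κ p.2).real B)
      - (κ p.2).real B * (κ p.2).real B) (μ ⊗ₘ κ) := (i12.const_mul 2).sub i22
  -- All three second moments equal `I`, so the expanded square integrates to `I - (2I - I) = 0`.
  have h0 : ∫ p, ((κ p.1).real B - (κ p.2).real B) ^ 2 ∂(μ ⊗ₘ κ) = 0 := by
    simp only [hsq]
    rw [integral_sub i11 i3, integral_sub (i12.const_mul 2) i22, integral_const_mul,
      h11, h12, h22]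
    ring
  rw [integral_eq_zero_iff_of_nonneg (fun p => sq_nonneg _)
    (by simp only [hsq]; exact i11.sub i3)] at h0
  filter_upwards [h0] with p hp
  simpa [sub_eq_zero] using hp

/-! ### Conditionally i.i.d. sequences. -/

section CondIID

variable {Ω : Type*} {m m' mΩ : MeasurableSpace Ω} {P : Measure Ω} [IsProbabilityMeasure P]
  {ξ : ℕ → Ω → ℝ} {ν : Ω → Measure ℝ}

theorem measurable_measureReal_of_measurable (hν : Measurable[m] ν) {A : Set ℝ}
    (hA : MeasurableSet A) : Measurable[m] fun ω => (ν ω).real A :=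
  ((Measure.measurable_coe hA).comp hν).ennreal_toReal

/-- If, along a filtration to which `ξ` is predictably adapted and which starts above `m`, every
`ξ n` has the `m`-measurable conditional law `ν`, then `ξ` is conditionally i.i.d. given `m`. -/
theorem isCondIIDWith_of_filtration {F : ℕ → MeasurableSpace Ω} (hF : ∀ n, F n ≤ mΩ)
    (hm : ∀ n, m ≤ F n) (hξ : ∀ n, Measurable (ξ n)) (hξF : ∀ i n, i < n → Measurable[F n] (ξ i))
    (hν : Measurable[m] ν) (hνp : ∀ ω, IsProbabilityMeasure (ν ω))
    (hcond : ∀ n A, MeasurableSet A → P⟦ξ n ⁻¹' A | F n⟧ =ᵐ[P] fun ω => (ν ω).real A) :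
    IsCondIIDWith P m ξ ν := by
  refine ⟨(hm 0).trans (hF 0), hν, hνp, fun s A hA => ?_⟩
  have hmΩ : m ≤ mΩ := (hm 0).trans (hF 0)
  have hνA : ∀ i, Measurable[m] fun ω => (ν ω).real (A i) :=
    fun i => measurable_measureReal_of_measurable hν (hA i)
  -- Adjoining the largest index last makes the earlier factors `F a`-measurable, so they can be
  -- pulled out when conditioning on `F a`.
  induction s using Finset.induction_on_max with
  | empty =>
    have : (⋂ i ∈ (∅ : Finset ℕ), ξ i ⁻¹' A i).indicator (fun _ => (1 : ℝ)) = fun _ => 1 := by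
      simp
    rw [this, condExp_const hmΩ]
    simp
  | insert a s has ih =>
    set D := ⋂ i ∈ s, ξ i ⁻¹' A i with hD
    have hDF : MeasurableSet[F a] D :=
      Finset.measurableSet_biInter s fun i hi => hξF i a (has i hi) (hA i)
    have hsplit : (⋂ i ∈ insert a s, ξ i ⁻¹' A i).indicator (fun _ => (1 : ℝ)) =
        D.indicator (fun _ => (1 : ℝ)) * (ξ a ⁻¹' A a).indicator (fun _ => (1 : ℝ)) := by
      rw [Finset.set_biInter_insert, inter_comm, ← hD]
      ext ω
      by_cases h1 : ω ∈ D <;> by_cases h2 : ω ∈ ξ a ⁻¹' A a <;> simp [h1, h2]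
    have hiD : Integrable (D.indicator (fun _ => (1 : ℝ))) P :=
      (integrable_const 1).indicator (hF a _ hDF)
    have hiB : Integrable ((ξ a ⁻¹' A a).indicator (fun _ => (1 : ℝ))) P :=
      (integrable_const 1).indicator (hξ a (hA a))
    have hiDB : Integrable (D.indicator (fun _ => (1 : ℝ)) *
        (ξ a ⁻¹' A a).indicator (fun _ => (1 : ℝ))) P := by
      rw [← hsplit]
      refine (integrable_const 1).indicator ?_
      exact Finset.measurableSet_biInter _ fun i _ => hξ i (hA i)
    have hiDν : Integrable (D.indicator (fun _ => (1 : ℝ)) * fun ω => (ν ω).real (A a)) P := by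
      refine hiD.mul_bdd (c := 1) ((hνA a).mono hmΩ le_rfl).aestronglyMeasurable ?_
      refine Eventually.of_forall fun ω => ?_
      have := hνp ω
      rw [Real.norm_of_nonneg measureReal_nonneg]
      exact measureReal_le_one
    rw [hsplit]
    calc P[D.indicator (fun _ => (1 : ℝ)) * (ξ a ⁻¹' A a).indicator (fun _ => (1 : ℝ)) | m]
        =ᵐ[P] P[P[D.indicator (fun _ => (1 : ℝ)) *
            (ξ a ⁻¹' A a).indicator (fun _ => (1 : ℝ)) | F a] | m] :=
          (condExp_condExp_of_le (hm a) (hF a)).symm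
      _ =ᵐ[P] P[D.indicator (fun _ => (1 : ℝ)) * fun ω => (ν ω).real (A a) | m] := by
          refine condExp_congr_ae ?_
          refine (condExp_mul_of_stronglyMeasurable_left
            (stronglyMeasurable_const.indicator hDF) hiDB hiB).trans ?_
          exact EventuallyEq.rfl.mul (hcond a _ (hA a))
      _ =ᵐ[P] P[D.indicator (fun _ => (1 : ℝ)) | m] * fun ω => (ν ω).real (A a) :=
          condExp_mul_of_stronglyMeasurable_right (hνA a).stronglyMeasurable hiDν hiD
      _ =ᵐ[P] fun ω => ∏ i ∈ insert a s, (ν ω).real (A i) := by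
          filter_upwards [ih] with ω hω
          have ha : a ∉ s := fun h => (has a h).false
          simp only [Pi.mul_apply]
          rw [hω, Finset.prod_insert ha, mul_comm]

theorem IsCondIIDWith.measureReal_biInter (h : IsCondIIDWith P m ξ ν) (hξ : ∀ n, Measurable (ξ n))
    (s : Finset ℕ) {A : ℕ → Set ℝ} (hA : ∀ i, MeasurableSet (A i)) :
    P.real (⋂ i ∈ s, ξ i ⁻¹' A i) = ∫ ω, ∏ i ∈ s, (ν ω).real (A i) ∂P := by
  rw [← integral_congr_ae (h.condProb s A hA), integral_condExp h.le,
    ← integral_indicator_one (Finset.measurableSet_biInter _ fun i _ => hξ i (hA i))]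
  rfl

/-- A conditionally i.i.d. sequence has the same law as each of its rearranged subsequences. -/
theorem IsCondIIDWith.identDistrib_of_injective (h : IsCondIIDWith P m ξ ν)
    (hξ : ∀ n, Measurable (ξ n)) {k : ℕ → ℕ} (hk : Function.Injective k) :
    IdentDistrib (fun ω i => ξ (k i) ω) (fun ω i => ξ i ω) P P := by
  have m1 : Measurable fun ω i => ξ (k i) ω := measurable_pi_lambda _ fun i => hξ (k i)
  have m2 : Measurable fun ω i => ξ i ω := measurable_pi_lambda _ fun i => hξ i
  refine ⟨m1.aemeasurable, m2.aemeasurable, ?_⟩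
  have := Measure.isProbabilityMeasure_map (μ := P) m1.aemeasurable
  have := Measure.isProbabilityMeasure_map (μ := P) m2.aemeasurable
  refine ext_of_generate_finite _ (generateFrom_squareCylinders (α := fun _ : ℕ => ℝ)).symm
    (isPiSystem_squareCylinders (fun _ => MeasurableSpace.isPiSystem_measurableSet) (by simp))
    ?_ (by simp)
  rintro _ ⟨s, t, ht, rfl⟩
  have ht' : ∀ i, MeasurableSet (t i) := fun i => ht i (mem_univ i)
  have hmeas : MeasurableSet ((s : Set ℕ).pi t) :=
    MeasurableSet.pi s.countable_toSet fun i _ => ht' i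
  rw [Measure.map_apply m1 hmeas, Measure.map_apply m2 hmeas]
  refine (measureReal_eq_measureReal_iff).1 ?_
  have e2 : (fun ω i => ξ i ω) ⁻¹' (s : Set ℕ).pi t = ⋂ i ∈ s, ξ i ⁻¹' t i := by
    ext ω; simp [Set.mem_pi]
  -- Reindexing by `k` turns the cylinder into one over `s.image k`; injectivity makes
  -- `Function.invFun k` recover the right set for each factor.
  have e1 : (fun ω i => ξ (k i) ω) ⁻¹' (s : Set ℕ).pi t =
      ⋂ j ∈ s.image k, ξ j ⁻¹' t (Function.invFun k j) := by
    ext ω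
    simp only [Set.mem_pi, mem_preimage, Finset.mem_coe, mem_iInter, Finset.forall_mem_image]
    exact forall₂_congr fun i _ => by rw [Function.leftInverse_invFun hk i]
  rw [e1, e2, h.measureReal_biInter hξ _ ht',
    h.measureReal_biInter hξ (A := fun j => t (Function.invFun k j)) _ fun j => ht' _]
  refine integral_congr_ae (Eventually.of_forall fun ω => ?_)
  simp only
  rw [Finset.prod_image hk.injOn]
  exact Finset.prod_congr rfl fun i _ => by rw [Function.leftInverse_invFun hk i]

/-- The law of large numbers in `L²` for conditionally i.i.d. indicators. -/
theorem IsCondIIDWith.integral_sum_sq_le (h : IsCondIIDWith P m ξ ν) (hξ : ∀ n, Measurable (ξ n))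
    {A : Set ℝ} (hA : MeasurableSet A) (n : ℕ) :
    Integrable (fun ω => (∑ i ∈ Finset.range n,
      ((ξ i ⁻¹' A).indicator (fun _ => (1 : ℝ)) ω - (ν ω).real A)) ^ 2) P ∧
    ∫ ω, (∑ i ∈ Finset.range n,
      ((ξ i ⁻¹' A).indicator (fun _ => (1 : ℝ)) ω - (ν ω).real A)) ^ 2 ∂P ≤ n := by
  set U : ℕ → Ω → ℝ := fun i => (ξ i ⁻¹' A).indicator (fun _ => (1 : ℝ)) with hU
  set g : Ω → ℝ := fun ω => (ν ω).real A with hg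
  have hgm : Measurable[m] g := measurable_measureReal_of_measurable h.measurable hA
  have hgM : Measurable g := hgm.mono h.le le_rfl
  have hUM : ∀ i, Measurable (U i) := fun i => measurable_const.indicator (hξ i hA)
  have hU01 : ∀ i ω, 0 ≤ U i ω ∧ U i ω ≤ 1 := fun i ω => by
    by_cases hω : ω ∈ ξ i ⁻¹' A <;> simp [hU, hω]
  have hg01 : ∀ ω, 0 ≤ g ω ∧ g ω ≤ 1 := fun ω =>
    have := h.isProbabilityMeasure ω
    ⟨measureReal_nonneg, measureReal_le_one⟩
  have hprod : ∀ f f' : Ω → ℝ, Measurable f → Measurable f' → (∀ ω, 0 ≤ f ω ∧ f ω ≤ 1) →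
      (∀ ω, 0 ≤ f' ω ∧ f' ω ≤ 1) → Integrable (fun ω => f ω * f' ω) P :=
    fun f f' hf hf' h1 h2 => Integrable.of_bound (hf.mul hf').aestronglyMeasurable 1
      (Eventually.of_forall fun ω => by
        rw [Real.norm_of_nonneg (mul_nonneg (h1 ω).1 (h2 ω).1)]
        exact mul_le_one₀ (h1 ω).2 (h2 ω).1 (h2 ω).2)
  have iUU := fun i j => hprod _ _ (hUM i) (hUM j) (hU01 i) (hU01 j)
  have iUg := fun i => hprod _ _ (hUM i) hgM (hU01 i) hg01
  have igg := hprod _ _ hgM hgM hg01 hg01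
  have eUg : ∀ i, ∫ ω, U i ω * g ω ∂P = ∫ ω, g ω * g ω ∂P := fun i => by
    have hc : P[U i | m] =ᵐ[P] g := by
      have := h.condProb {i} (fun _ => A) fun _ => hA
      simpa using this
    have h1 : P[U i * g | m] =ᵐ[P] P[U i | m] * g :=
      condExp_mul_of_stronglyMeasurable_right hgm.stronglyMeasurable (iUg i)
        ((integrable_const 1).indicator (hξ i hA))
    rw [← integral_condExp h.le (f := fun ω => U i ω * g ω)]
    refine integral_congr_ae ?_
    filter_upwards [h1, hc] with ω h1 h2
    refine h1.trans ?_
    simp [h2]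
  have eUU : ∀ i j, i ≠ j → ∫ ω, U i ω * U j ω ∂P = ∫ ω, g ω * g ω ∂P := fun i j hij => by
    have := h.measureReal_biInter hξ {i, j} (A := fun _ => A) fun _ => hA
    rw [Finset.set_biInter_insert, Finset.set_biInter_singleton] at this
    simp only [Finset.prod_pair hij] at this
    rw [← this, ← integral_indicator_one ((hξ i hA).inter (hξ j hA))]
    refine integral_congr_ae (Eventually.of_forall fun ω => ?_)
    by_cases h1 : ω ∈ ξ i ⁻¹' A <;> by_cases h2 : ω ∈ ξ j ⁻¹' A <;>
      simp only [hU, indicator, mem_inter_iff, h1, h2] <;> simp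
  have hZZ : ∀ i j ω, (U i ω - g ω) * (U j ω - g ω) =
      (U i ω * U j ω - U i ω * g ω) - (U j ω * g ω - g ω * g ω) := fun i j ω => by ring
  have i1 : ∀ i j, Integrable (fun ω => U i ω * U j ω - U i ω * g ω) P :=
    fun i j => (iUU i j).sub (iUg i)
  have i2 : ∀ j, Integrable (fun ω => U j ω * g ω - g ω * g ω) P :=
    fun j => (iUg j).sub igg
  have iZZ : ∀ i j, Integrable (fun ω => (U i ω - g ω) * (U j ω - g ω)) P := fun i j => by
    simp only [hZZ]
    exact (i1 i j).sub (i2 j)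
  -- The centred indicators are pairwise orthogonal and bounded by 1, so only the `n` diagonal terms
  -- contribute.
  have eZZ : ∀ i j, ∫ ω, (U i ω - g ω) * (U j ω - g ω) ∂P ≤ if i = j then 1 else 0 := by
    intro i j
    split_ifs with hij
    · have : ∀ ω, (U i ω - g ω) * (U j ω - g ω) ≤ 1 := fun ω => by
        subst hij
        have := hU01 i ω
        have := hg01 ω
        nlinarith
      calc _ ≤ ∫ _ω, (1 : ℝ) ∂P := integral_mono (iZZ i j) (integrable_const 1) this
        _ = 1 := by simp
    · simp only [hZZ]
      rw [integral_sub (i1 i j) (i2 j), integral_sub (iUU i j) (iUg i), integral_sub (iUg j) igg,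
        eUU i j hij, eUg, eUg]
      simp
  have hexp : ∀ ω, (∑ i ∈ Finset.range n, (U i ω - g ω)) ^ 2 =
      ∑ i ∈ Finset.range n, ∑ j ∈ Finset.range n, (U i ω - g ω) * (U j ω - g ω) := fun ω => by
    rw [sq, Finset.sum_mul_sum]
  change Integrable (fun ω => (∑ i ∈ Finset.range n, (U i ω - g ω)) ^ 2) P ∧
    ∫ ω, (∑ i ∈ Finset.range n, (U i ω - g ω)) ^ 2 ∂P ≤ n
  simp only [hexp]
  have iS : ∀ i ∈ Finset.range n,
      Integrable (fun ω => ∑ j ∈ Finset.range n, (U i ω - g ω) * (U j ω - g ω)) P :=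
    fun i _ => integrable_finsetSum _ fun j _ => iZZ i j
  refine ⟨integrable_finsetSum _ iS, ?_⟩
  rw [integral_finsetSum _ iS]
  calc _ ≤ ∑ i ∈ Finset.range n, (1 : ℝ) := by
        refine Finset.sum_le_sum fun i hi => ?_
        rw [integral_finsetSum _ fun j _ => iZZ i j]
        refine (Finset.sum_le_sum fun j _ => eZZ i j).trans ?_
        rw [Finset.sum_ite_eq, if_pos hi]
    _ = n := by simp

/-- The conditional law of a conditionally i.i.d. sequence is determined by the sequence. -/
theorem IsCondIIDWith.ae_eq {ν' : Ω → Measure ℝ}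
    (h : IsCondIIDWith P m ξ ν) (h' : IsCondIIDWith P m' ξ ν') (hξ : ∀ n, Measurable (ξ n)) :
    ν' =ᵐ[P] ν := by
  refine ae_eq_of_forall_measureReal_ae_eq h'.isProbabilityMeasure h.isProbabilityMeasure
    fun A hA => ?_
  have hgM : Measurable fun ω => (ν ω).real A :=
    (measurable_measureReal_of_measurable h.measurable hA).mono h.le le_rfl
  have hgM' : Measurable fun ω => (ν' ω).real A :=
    (measurable_measureReal_of_measurable h'.measurable hA).mono h'.le le_rfl
  have hi : Integrable (fun ω => ((ν' ω).real A - (ν ω).real A) ^ 2) P := by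
    refine Integrable.of_bound ((hgM'.sub hgM).pow_const 2).aestronglyMeasurable 1
      (Eventually.of_forall fun ω => ?_)
    have := h.isProbabilityMeasure ω
    have := h'.isProbabilityMeasure ω
    have h1 : (ν ω).real A ≤ 1 := measureReal_le_one
    have h2 : (ν' ω).real A ≤ 1 := measureReal_le_one
    have h3 : 0 ≤ (ν ω).real A := measureReal_nonneg
    have h4 : 0 ≤ (ν' ω).real A := measureReal_nonneg
    rw [Real.norm_of_nonneg (sq_nonneg _)]
    nlinarith
  set I := ∫ ω, ((ν' ω).real A - (ν ω).real A) ^ 2 ∂P with hI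
  -- With `S` the number of visits to `A`, apply `(a - b)² ≤ 2a² + 2b²` to `a = S - nν(A)` and `b =
  -- S - nν'(A)`, each of second moment at most `n`.
  have hle : ∀ n : ℕ, (n : ℝ) ^ 2 * I ≤ 4 * n := by
    intro n
    obtain ⟨i1, b1⟩ := h.integral_sum_sq_le hξ hA n
    obtain ⟨i2, b2⟩ := h'.integral_sum_sq_le hξ hA n
    rw [hI, ← integral_const_mul]
    refine (integral_mono (hi.const_mul _) ((i1.const_mul 2).add (i2.const_mul 2))
      fun ω => ?_).trans ?_
    · simp only [Finset.sum_sub_distrib, Finset.sum_const, Finset.card_range, nsmul_eq_mul,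
        Pi.add_apply]
      set S := ∑ i ∈ Finset.range n, (ξ i ⁻¹' A).indicator (fun _ => (1 : ℝ)) ω
      nlinarith [sq_nonneg ((S - n * (ν ω).real A) + (S - n * (ν' ω).real A))]
    · simp only [Pi.add_apply]
      rw [integral_add (i1.const_mul 2) (i2.const_mul 2), integral_const_mul, integral_const_mul]
      linarith
  have hI0 : 0 ≤ I := integral_nonneg fun _ => sq_nonneg _
  have hIz : I = 0 := by
    by_contra hne
    have hpos : 0 < I := lt_of_le_of_ne hI0 (Ne.symm hne)
    obtain ⟨n, hn⟩ := exists_nat_gt (4 / I)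
    have hn0 : (0 : ℝ) < n := (by positivity : (0 : ℝ) < 4 / I).trans hn
    rw [div_lt_iff₀ hpos] at hn
    have := hle n
    nlinarith
  rw [hI, integral_eq_zero_iff_of_nonneg (fun _ => sq_nonneg _) hi] at hIz
  filter_upwards [hIz] with ω hω
  simpa [sub_eq_zero] using hω

end CondIID

/-! ### Stationary Markov chains governed by an idempotent copula. -/

section MarkovChain

variable {Ω : Type*} [mΩ : MeasurableSpace Ω] {P : Measure Ω} [IsProbabilityMeasure P]
  {X : ℕ → Ω → ℝ} {C : Copula}

theorem sigmaPast_le (hX : ∀ n, Measurable (X n)) (n : ℕ) : sigmaPast X n ≤ mΩ :=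
  iSup₂_le fun i _ => (hX i).comap_le

theorem measurable_sigmaPast {Ω : Type*} {X : ℕ → Ω → ℝ} {i n : ℕ} (h : i ≤ n) : Measurable[sigmaPast X n] (X i) :=
  Measurable.of_comap_le (le_iSup₂_of_le (f := fun i (_ : i ∈ Set.Iic n) =>
    MeasurableSpace.comap (X i) inferInstance) i h le_rfl)

/-- The transition kernel of a stationary Markov chain governed by an idempotent copula is
a.s. constant along the chain. -/
theorem IsMarkovChainWithCopula.exists_kernel (hX : IsMarkovChainWithCopula P X C)
    (hC : C.IsIdempotent) :
    ∃ κ : Kernel ℝ ℝ, IsMarkovKernel κ ∧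
      (∀ (n : ℕ) (A : Set ℝ), MeasurableSet A →
        P⟦X (n + 1) ⁻¹' A | sigmaOf (X n)⟧ =ᵐ[P] fun ω => (κ (X n ω)).real A) ∧
      ∀ (n : ℕ) (A : Set ℝ), MeasurableSet A →
        ∀ᵐ ω ∂P, (κ (X n ω)).real A = (κ (X (n + 1) ω)).real A := by
  set μ := P.map (X 0) with hμ
  have hμp : IsProbabilityMeasure μ :=
    Measure.isProbabilityMeasure_map (hX.measurable 0).aemeasurable
  have hlaw : ∀ n, P.map (X n) = μ := fun n => (hX.identDistrib n).map_eq
  have hpair : ∀ n, Measurable fun ω => (X n ω, X (n + 1) ω) :=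
    fun n => (hX.measurable n).prodMk (hX.measurable (n + 1))
  set R := C.law.map (Prod.map (quantile μ) (quantile μ)) with hR
  have hQ := measurable_quantile μ
  have hRp : IsProbabilityMeasure R :=
    Measure.isProbabilityMeasure_map (hQ.prodMap hQ).aemeasurable
  -- All consecutive pairs share the law `R`, so one kernel serves every transition.
  have hRn : ∀ n, R = P.map fun ω => (X n ω, X (n + 1) ω) := fun n => by
    have := Measure.isProbabilityMeasure_map (μ := P) (hpair n).aemeasurable
    refine C.map_quantile_eq fun x y => ?_
    have h := (hX.hasCopula n).sklar x y
    rw [hlaw, hlaw] at h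
    rw [h, map_measureReal_apply (hpair n) (measurableSet_Iic.prod measurableSet_Iic)]
    rfl
  have hfst : R.fst = μ := by
    rw [hRn 0, Measure.fst_map_prodMk (hX.measurable 1)]
  have hsnd : R.snd = μ := by
    rw [hRn 0, Measure.snd_map_prodMk (hX.measurable 0), hlaw]
  set κ := R.condKernel with hκ
  have hdis : R = μ ⊗ₘ κ := by
    conv_lhs => rw [← R.disintegrate κ, hfst]
  refine ⟨κ, inferInstance, fun n A hA => ?_, fun n A hA => ?_⟩
  · have := condDistrib_ae_eq_condExp (μ := P) (hX.measurable n) (hX.measurable (n + 1)) hA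
    simp only [condDistrib, ← hRn n] at this
    exact this.symm
  · have h := (hX.hasCopula 0).interp_left
    rw [hlaw] at h
    have h1 := hC.lintegral_mul hdis (C.map_id_quantile_eq hdis h) hA
    have h2 := ae_kernel_eq_of_lintegral_mul (by rw [← hdis, hsnd]) hA h1
    rw [← hdis, hRn n] at h2
    exact ae_of_ae_map (hpair n).aemeasurable h2

theorem ae_kernel_eq_kernel_zero {Ω : Type*} [MeasurableSpace Ω] {P : Measure Ω}
    {X : ℕ → Ω → ℝ} {κ : Kernel ℝ ℝ}
    (h : ∀ (n : ℕ) (A : Set ℝ), MeasurableSet A →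
      ∀ᵐ ω ∂P, (κ (X n ω)).real A = (κ (X (n + 1) ω)).real A)
    (n : ℕ) {A : Set ℝ} (hA : MeasurableSet A) :
    (fun ω => (κ (X n ω)).real A) =ᵐ[P] fun ω => (κ (X 0 ω)).real A := by
  induction n with
  | zero => exact EventuallyEq.rfl
  | succ n ih => exact (EventuallyEq.symm (h n A hA)).trans ih

/-- If the transition kernel is a.s. constant along a stationary Markov chain, it is the conditional
law of `X₀` given itself. -/
theorem condExp_zero_ae_eq (hX : ∀ n, Measurable (X n))
    (hid : IdentDistrib (X 1) (X 0) P P) {κ : Kernel ℝ ℝ} [IsMarkovKernel κ]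
    (hκ : ∀ A : Set ℝ, MeasurableSet A →
      P⟦X 1 ⁻¹' A | sigmaOf (X 0)⟧ =ᵐ[P] fun ω => (κ (X 0 ω)).real A)
    (hconst : ∀ A : Set ℝ, MeasurableSet A →
      ∀ᵐ ω ∂P, (κ (X 0 ω)).real A = (κ (X 1 ω)).real A)
    {A : Set ℝ} (hA : MeasurableSet A) :
    P⟦X 0 ⁻¹' A | sigmaOf fun ω => κ (X 0 ω)⟧ =ᵐ[P] fun ω => (κ (X 0 ω)).real A := by
  have hle0 : sigmaOf (X 0) ≤ mΩ := (hX 0).comap_le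
  have hη0 : Measurable[sigmaOf (X 0)] fun ω => κ (X 0 ω) :=
    κ.measurable.comp (comap_measurable (X 0))
  have hle : sigmaOf (fun ω => κ (X 0 ω)) ≤ sigmaOf (X 0) := hη0.comap_le
  have heq : (fun ω => κ (X 0 ω)) =ᵐ[P] fun ω => κ (X 1 ω) :=
    ae_eq_of_forall_measureReal_ae_eq (fun _ => inferInstance) (fun _ => inferInstance) hconst
  have hm : Measurable[sigmaOf fun ω => κ (X 0 ω)] fun ω => (κ (X 0 ω)).real A :=
    measurable_measureReal_of_measurable (comap_measurable _) hA
  have hi : Integrable (fun ω => (κ (X 0 ω)).real A) P :=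
    Integrable.of_bound (hm.mono (hle.trans hle0) le_rfl).aestronglyMeasurable 1
      (Eventually.of_forall fun ω => by
        rw [Real.norm_of_nonneg measureReal_nonneg]
        exact measureReal_le_one)
  have hiX : ∀ n, Integrable ((X n ⁻¹' A).indicator fun _ => (1 : ℝ)) P :=
    fun n => (integrable_const 1).indicator (hX n hA)
  refine (ae_eq_condExp_of_forall_setIntegral_eq (hle.trans hle0) (hiX 0)
    (fun _ _ _ => hi.integrableOn) ?_ hm.stronglyMeasurable.aestronglyMeasurable).symm
  rintro T ⟨B, hB, rfl⟩ -
  have hT : MeasurableSet[sigmaOf (X 0)] ((fun ω => κ (X 0 ω)) ⁻¹' B) := hη0 hB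
  have hset : ∀ n, ∫ ω in (fun ω => κ (X 0 ω)) ⁻¹' B, (X n ⁻¹' A).indicator (fun _ => (1 : ℝ)) ω ∂P
      = P.real (X n ⁻¹' A ∩ (fun ω => κ (X 0 ω)) ⁻¹' B) := fun n => by
    rw [setIntegral_indicator (hX n hA), inter_comm]
    simp
  rw [← setIntegral_congr_ae (g := fun ω => (κ (X 0 ω)).real A) (hle0 _ hT)
    ((hκ A hA).mono fun ω h _ => h), setIntegral_condExp hle0 (hiX 1) hT, hset, hset]
  have hAB : MeasurableSet (A ∩ κ ⁻¹' B) := hA.inter (κ.measurable hB)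
  -- In the event `κ(X₀) ∈ B`, `X₀` may be replaced by `X₁` up to a null set; the event then
  -- involves `X₁` alone and stationarity moves it back to `X₀`.
  calc P.real (X 1 ⁻¹' A ∩ (fun ω => κ (X 0 ω)) ⁻¹' B)
      = P.real (X 1 ⁻¹' (A ∩ κ ⁻¹' B)) := by
        refine measureReal_congr ?_
        filter_upwards [heq] with ω hω
        refine propext (and_congr_right fun _ => ?_)
        change κ (X 0 ω) ∈ B ↔ κ (X 1 ω) ∈ B
        rw [hω]
    _ = P.real (X 0 ⁻¹' (A ∩ κ ⁻¹' B)) := by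
        rw [measureReal_def, measureReal_def, hid.measure_mem_eq hAB]
    _ = _ := rfl

end MarkovChain

/-! ### The four conclusions. -/

theorem mainTheorem4 {Ω : Type*} [MeasurableSpace Ω] (P : Measure Ω) [IsProbabilityMeasure P]
    (X : ℕ → Ω → ℝ) (C : Copula) (hX : IsMarkovChainWithCopula P X C) (hC : C.IsIdempotent) :
    IsSpreadable P X ∧
    IsExchangeable P X ∧
    (∀ (n : ℕ) (A : Set ℝ), MeasurableSet A →
      P⟦X (n + 1) ⁻¹' A | sigmaPast X n⟧ =ᵐ[P] P⟦X (n + 1) ⁻¹' A | sigmaOf (X 0)⟧) ∧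
    ∃ η : Ω → Measure ℝ,
      IsDirectingMeasure P X η ∧
      (∀ η' : Ω → Measure ℝ, IsDirectingMeasure P X η' → η' =ᵐ[P] η) ∧
      Measurable[sigmaOf (X 0)] η ∧
      IsCondIIDWith P (sigmaOf (X 0)) (fun n => X (n + 1)) η := by
  obtain ⟨κ, _, hκ, hconst⟩ := hX.exists_kernel hC
  have hXm := hX.measurable
  set η : Ω → Measure ℝ := fun ω => κ (X 0 ω) with hη
  have hηp : ∀ ω, IsProbabilityMeasure (η ω) := fun ω => inferInstance
  have hη0 : Measurable[sigmaOf (X 0)] η := κ.measurable.comp (comap_measurable (X 0))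
  have hle0 : sigmaOf (X 0) ≤ _ := (hXm 0).comap_le
  have h0past : ∀ n, sigmaOf (X 0) ≤ sigmaPast X n :=
    fun n => (measurable_sigmaPast (Nat.zero_le n)).comap_le
  have hηle : sigmaOf η ≤ sigmaOf (X 0) := hη0.comap_le
  have hpast : ∀ (n : ℕ) (A : Set ℝ), MeasurableSet A →
      P⟦X (n + 1) ⁻¹' A | sigmaPast X n⟧ =ᵐ[P] fun ω => (η ω).real A := fun n A hA =>
    ((hX.markov n A hA).trans (hκ n A hA)).trans (ae_kernel_eq_kernel_zero hconst n hA)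
  have hdir : IsDirectingMeasure P X η := by
    -- The filtration is `σ(η)`, `σ(X₀)`, `σ(X₀, X₁)`, …: starting at `σ(η)` includes `X₀` in the
    -- i.i.d. sequence.
    refine isCondIIDWith_of_filtration
      (F := fun n => Nat.casesOn n (sigmaOf η) fun n => sigmaPast X n) ?_ ?_ hXm ?_
      (comap_measurable η) hηp ?_
    · rintro (_ | n)
      exacts [hηle.trans hle0, sigmaPast_le hXm n]
    · rintro (_ | n)
      exacts [le_rfl, hηle.trans (h0past n)]
    · rintro i (_ | n) hi
      exacts [absurd hi (Nat.not_lt_zero i), measurable_sigmaPast (Nat.lt_succ_iff.1 hi)]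
    · rintro (_ | n) A hA
      exacts [condExp_zero_ae_eq hXm (hX.identDistrib 1) (hκ 0) (hconst 0) hA, hpast n A hA]
  refine ⟨fun k hk => hdir.identDistrib_of_injective hXm hk.injective,
    fun k _ => hdir.identDistrib_of_injective hXm k.injective, fun n A hA => ?_,
    η, hdir, fun η' hη' => hdir.ae_eq hη' hXm, hη0, ?_⟩
  -- The conditional probability given the past is a.s. `η(A)`, which is already `σ(X₀)`-measurable,
  -- so projecting onto `σ(X₀)` leaves it unchanged.
  · have hm := measurable_measureReal_of_measurable hη0 hA
    have hi : Integrable (fun ω => (η ω).real A) P :=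
      (integrable_condExp (m := sigmaPast X n)).congr (hpast n A hA)
    refine (hpast n A hA).trans (EventuallyEq.symm ?_)
    refine (condExp_condExp_of_le (h0past n) (sigmaPast_le hXm n)).symm.trans ?_
    refine (condExp_congr_ae (hpast n A hA)).trans ?_
    rw [condExp_of_stronglyMeasurable hle0 hm.stronglyMeasurable hi]
  · exact isCondIIDWith_of_filtration (F := fun n => sigmaPast X n) (sigmaPast_le hXm) h0past
      (fun n => hXm (n + 1)) (fun i n hi => measurable_sigmaPast hi) hη0 hηp hpast
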